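/- **Finite Consistency Test.** Consider a finite extensive-form game with perfect recall: a finite prefix-closed set $H$ of action sequences (histories), a partition $\mathcal I$ of the non-terminal histories into information sets $I$, each with one acting player and one set $A(I)$ of available actions. (The game has no chance moves. Actions available at different information sets are regarded as different.) An assessment $(\beta,\mu)$ gives for each $I\in\mathcal I$ a probability distribution $\beta(I)$ on $A(I)$ and a probability distribution $\mu(I)$ on $I$. Let $P_\beta(h)$ be the product of the probabilities under $\beta$ of the actions in $h$, and $P_\beta(I)=\sum_{h\in I}P_\beta(h)$. The assessment is *consistent* if there are assessments $(\beta^n,\mu^n)\to(\beta,\mu)$ such that for all $n$, $P_{\beta^n}(h)>0$ for all $h\in H$ and $\mu^n(I)(h)=P_{\beta^n}(h)/P_{\beta^n}(I)$ for all $I\in\mathcal I$, $h\in I$. Let $a_1,\dots,a_N$ be all actions of the game, and let $(h^1_i,h^2_i)$ run through pairs of histories lying in a common information set, such that any two distinct histories of an information set occur in at least one order (for instance, all such ordered pairs). Let $Ax=b$ be the linear system with one column per action and the following rows. * For each pair $i$ for which $\mu(h^1_i)$ and $\mu(h^2_i)$ are not both $0$: $A_{ij}=1$ if $a_j$ occurs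 in $h^1_i$ but not in $h^2_i$, $A_{ij}=-1$ if $a_j$ occurs in $h^2_i$ but not in $h^1_i$, $A_{ij}=0$ otherwise; and $b_i=\log\mu(h^1_i)-\log\mu(h^2_i)$. * For each action $a_k$: the row of $A$ is the $k$-th unit vector, and $b$ has the entry $\log\beta(a_k)$. Here $\log 0=-\infty$, so $b_i\in[-\infty,\infty]$. Let $M$ be the number of rows. Say that $p\in\mathbb R^M$ has property (K) if $\sum_{p_i\ne0}p_ib_i$ is $0$ or is ill-defined (has both $\infty$ and $-\infty$ among its terms). Let $$C^A_b=\{p\in\mathbb R^M \mid pA=0,\ p_i\ge 0\text{ if }b_i=\infty,\ p_i\le 0\text{ if }b_i=-\infty\}.$$ A *conical basis* of $C^A_b$ is a finite set $\{e_1,\dots,e_k\}$ such that $C^A_b=\{\lambda_1e_1+\dots+\lambda_ke_k\mid\lambda_1,\dots,\lambda_k\ge0\}$. Then: 1. For every conical basis $E$ of $C^A_b$, the assessment $(\beta,\mu)$ is consistent if and only if (K) holds for all $p\in E$. 2. The choice of the conical basis is irrelevant: if $E$ and $E'$ are conical bases of $C^A_b$, then (K) holds for all $p\in E$ if and only if it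 holds for all $p\in E'$. 3. A conical basis of $C^A_b$ exists, even one all of whose vectors have integer components. -/

import Mathlib

open Filter Topology

/-- A finite tree of histories. A history is the sequence of the actions leading to a node. -/
structure GameTree (Act : Type*) where
  /-- the finite set `H` of histories -/
  histories : Finset (List Act)
  nil_mem : [] ∈ histories
  prefix_mem : ∀ h h' : List Act, h <+: h' → h' ∈ histories → h ∈ histories

namespace GameTree

variable {Act : Type*} (T : GameTree Act)

/-- `h` is a terminal history: it is a prefix of no other history. -/
def IsTerminal (h : List Act) : Prop :=
  h ∈ T.histories ∧ ∀ h' ∈ T.histories, h <+: h' → h' = h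

/-- `h` is a non-terminal history. -/
def IsNonterminal (h : List Act) : Prop :=
  h ∈ T.histories ∧ ¬ T.IsTerminal h

end GameTree

/-- A finite extensive-form game (of imperfect information). The set `A(h)` of actions available
after a non-terminal history `h` consists of the `a` for which `h ++ [a]` is a history. -/
structure ExtensiveGame (Player Act : Type*) extends GameTree Act where
  /-- the acting player at each non-terminal history -/
  player : {h : List Act // toGameTree.IsNonterminal h} → Player
  /-- the utility of each player at each terminal history -/
  utility : Player → {h : List Act // toGameTree.IsTerminal h} → ℝ
  /-- the information sets; they partition the non-terminal histories -/
  infoSets : Finset (Finset (List Act))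
  info_nonempty : ∀ I ∈ infoSets, I.Nonempty
  info_nonterminal : ∀ I ∈ infoSets, ∀ h ∈ I, toGameTree.IsNonterminal h
  info_partition : ∀ h, toGameTree.IsNonterminal h → ∃! I, I ∈ infoSets ∧ h ∈ I
  /-- the acting player is the same at all histories of an information set -/
  same_player : ∀ (I : Finset (List Act)) (hI : I ∈ infoSets) (h h' : List Act)
    (hh : h ∈ I) (hh' : h' ∈ I),
    player ⟨h, info_nonterminal I hI h hh⟩ = player ⟨h', info_nonterminal I hI h' hh'⟩
  /-- the available actions are the same at all histories of an information set -/
  same_actions : ∀ I ∈ infoSets, ∀ h ∈ I, ∀ h' ∈ I, ∀ a : Act,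
    h ++ [a] ∈ histories ↔ h' ++ [a] ∈ histories

namespace ExtensiveGame

variable {Player Act : Type*} (G : ExtensiveGame Player Act)

/-- The type of histories `H`. -/
abbrev Hist : Type _ := {h : List Act // h ∈ G.histories}

/-- The type of information sets. -/
abbrev Info : Type _ := {I : Finset (List Act) // I ∈ G.infoSets}

variable {G}

/-- The histories in the information set `I`. -/
abbrev HistIn (I : G.Info) : Type _ := {h : List Act // h ∈ I.1}

/-- A history in an information set, as a history of the game. -/
def HistIn.toHist {I : G.Info} (h : HistIn I) : G.Hist :=
  ⟨h.1, (G.info_nonterminal I.1 I.2 h.1 h.2).1⟩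

/-- The set `A(I)` of actions available at `I`. -/
abbrev Action (I : G.Info) : Type _ := {a : Act // ∃ h ∈ I.1, h ++ [a] ∈ G.histories}

instance (I : G.Info) : Finite (Action I) := by
  obtain ⟨h, hh⟩ := G.info_nonempty I.1 I.2
  have key : ∀ a : Action I, h ++ [a.1] ∈ G.histories := by
    rintro ⟨a, h', hh', ha⟩
    exact (G.same_actions I.1 I.2 h' hh' h hh a).1 ha
  refine Finite.of_injective (fun a : Action I => (⟨h ++ [a.1], key a⟩ : G.Hist)) ?_
  intro a a' haa
  have h1 : h ++ [a.1] = h ++ [a'.1] := congrArg Subtype.val haa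
  exact Subtype.ext (by simpa using h1)

noncomputable instance (I : G.Info) : Fintype (Action I) := Fintype.ofFinite _

/-- The acting player `N(I)`. -/
noncomputable def playerAt (I : G.Info) : Player :=
  G.player ⟨(G.info_nonempty I.1 I.2).choose,
    G.info_nonterminal I.1 I.2 _ (G.info_nonempty I.1 I.2).choose_spec⟩

/-- The information set containing a non-terminal history. -/
noncomputable def infoOf (h : List Act) (hh : G.IsNonterminal h) : G.Info :=
  ⟨(G.info_partition h hh).choose, (G.info_partition h hh).choose_spec.1.1⟩

theorem mem_infoOf (h : List Act) (hh : G.IsNonterminal h) : h ∈ (infoOf h hh).1 :=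
  (G.info_partition h hh).choose_spec.1.2

variable (G) in
/-- All actions of the game. An action is recorded together with the information set at which it is
available, so that each action belongs to exactly one information set. -/
abbrev Choice : Type _ := Σ I : G.Info, Action I

theorem take_isNonterminal (h : G.Hist) (k : Fin h.1.length) : G.IsNonterminal (h.1.take k) := by
  refine ⟨G.prefix_mem _ _ (List.take_prefix _ _) h.2, fun ht => ?_⟩
  have h1 := congrArg List.length (ht.2 h.1 h.2 (List.take_prefix _ _))
  have := k.2
  simp at h1
  omega

theorem take_append_mem (h : G.Hist) (k : Fin h.1.length) :
    h.1.take k ++ [h.1.get k] ∈ G.histories := by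
  refine G.prefix_mem _ _ ?_ h.2
  have : h.1.take k ++ [h.1.get k] = h.1.take (k + 1) := by simp
  rw [this]
  exact List.take_prefix _ _

/-- The `k`-th action on the path of the history `h` (counted from `0`), with the information set
at which it is taken. -/
noncomputable def choiceAt (h : G.Hist) (k : Fin h.1.length) : G.Choice :=
  ⟨infoOf (h.1.take k) (take_isNonterminal h k),
    ⟨h.1.get k, h.1.take k, mem_infoOf _ _, take_append_mem h k⟩⟩

/-- The sequence of actions on the path of the history `h`. -/
noncomputable def choices (h : G.Hist) : List G.Choice := List.ofFn (choiceAt h)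

open Classical in
/-- The sequence of information sets encountered and actions played by player `i` along `h`. -/
noncomputable def experience (i : Player) (h : G.Hist) : List G.Choice :=
  (choices h).filter (fun c => playerAt c.1 = i)

variable (G) in
/-- Perfect recall: at any two histories in the same information set the acting player has
encountered the same information sets and played the same actions. -/
def PerfectRecall : Prop :=
  ∀ (I : G.Info) (h h' : HistIn I),
    experience (playerAt I) h.toHist = experience (playerAt I) h'.toHist

variable (G) in
/-- An assessment `(β, μ)`: a profile of behavioral strategies and a system of beliefs. -/
structure Assessment where
  /-- `strat I a` is the probability `β(I)(a)` -/
  strat : ∀ I : G.Info, Action I → ℝ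
  strat_mem : ∀ I, strat I ∈ stdSimplex ℝ (Action I)
  /-- `belief I h` is the probability `μ(I)(h)` -/
  belief : ∀ I : G.Info, HistIn I → ℝ
  belief_mem : ∀ I, belief I ∈ stdSimplex ℝ (HistIn I)

namespace Assessment

/-- The probability `P_β(h)` of reaching the history `h`. -/
noncomputable def reach (σ : G.Assessment) (h : G.Hist) : ℝ :=
  ((choices h).map (fun c => σ.strat c.1 c.2)).prod

/-- The probability `P_β(I)` of reaching the information set `I`. -/
noncomputable def reachInfo (σ : G.Assessment) (I : G.Info) : ℝ :=
  ∑ h : HistIn I, σ.reach h.toHist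

/-- Consistency of an assessment: it is a limit of assessments that reach every history with
positive probability and whose beliefs are given by Bayes' rule. -/
def Consistent (σ : G.Assessment) : Prop :=
  ∃ s : ℕ → G.Assessment,
    Tendsto (fun n => (s n).strat) atTop (𝓝 σ.strat) ∧
    Tendsto (fun n => (s n).belief) atTop (𝓝 σ.belief) ∧
    ∀ n, (∀ h : G.Hist, 0 < (s n).reach h) ∧
      ∀ (I : G.Info) (h : HistIn I),
        (s n).belief I h = (s n).reach h.toHist / (s n).reachInfo I

end Assessment

variable (G) in
/-- Ordered pairs of histories that lie in the same information set. -/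
abbrev HistPair : Type _ := Σ I : G.Info, HistIn I × HistIn I

/-- The rows of the linear system: one for each of the given pairs `(h¹, h²)` whose right-hand side
is well defined, that is, `μ(h¹)` and `μ(h²)` are not both `0`, and one for each action. -/
abbrev Row (σ : G.Assessment) (pairs : Finset G.HistPair) : Type _ :=
  {q : G.HistPair // q ∈ pairs ∧ ¬ (σ.belief q.1 q.2.1 = 0 ∧ σ.belief q.1 q.2.2 = 0)} ⊕ G.Choice

noncomputable instance (σ : G.Assessment) (pairs : Finset G.HistPair) : Fintype (Row σ pairs) :=
  Fintype.ofFinite _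

open Classical in
/-- The matrix `A`: the block for the pairs of histories on top of the identity matrix. -/
noncomputable def sysMatrix (σ : G.Assessment) (pairs : Finset G.HistPair) :
    Matrix (Row σ pairs) G.Choice ℝ :=
  Matrix.fromRows
    (Matrix.of fun q c =>
      if c ∈ choices q.1.2.1.toHist ∧ c ∉ choices q.1.2.2.toHist then 1
      else if c ∉ choices q.1.2.1.toHist ∧ c ∈ choices q.1.2.2.toHist then -1
      else 0)
    1

/-- The numerators `α`. -/
def alpha (σ : G.Assessment) (pairs : Finset G.HistPair) : Row σ pairs → ℝ
  | Sum.inl q => σ.belief q.1.1 q.1.2.1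
  | Sum.inr c => σ.strat c.1 c.2

/-- The denominators `γ`. -/
def gamma (σ : G.Assessment) (pairs : Finset G.HistPair) : Row σ pairs → ℝ
  | Sum.inl q => σ.belief q.1.1 q.1.2.2
  | Sum.inr _ => 1

/-- The right-hand side `b = log α - log γ`, where `log 0 = -∞`. -/
noncomputable def sysRhs (σ : G.Assessment) (pairs : Finset G.HistPair) (i : Row σ pairs) : EReal :=
  ENNReal.log (ENNReal.ofReal (alpha σ pairs i)) - ENNReal.log (ENNReal.ofReal (gamma σ pairs i))

end ExtensiveGame

section LinearSystems

variable {ι κ : Type*} [Fintype ι]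

/-- The sum of the `p i * b i` over the `i` with `p i ≠ 0` is ill-defined: both `∞` and `-∞`
occur among its terms. -/
def SumIllDefined (b : ι → EReal) (p : ι → ℝ) : Prop :=
  (∃ i, p i ≠ 0 ∧ (p i : EReal) * b i = ⊤) ∧ (∃ j, p j ≠ 0 ∧ (p j : EReal) * b j = ⊥)

open Classical in
/-- The sum of the `p i * b i` over the `i` with `p i ≠ 0` is zero or ill-defined. -/
def SumZeroOrIllDefined (b : ι → EReal) (p : ι → ℝ) : Prop :=
  (¬ SumIllDefined b p ∧ ∑ i ∈ Finset.univ.filter (fun i => p i ≠ 0), (p i : EReal) * b i = 0) ∨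
    SumIllDefined b p

/-- The cone `C^A_b`. -/
def systemCone (A : Matrix ι κ ℝ) (b : ι → EReal) : Set (ι → ℝ) :=
  {p | Matrix.vecMul p A = 0 ∧ (∀ i, b i = ⊤ → 0 ≤ p i) ∧ (∀ i, b i = ⊥ → p i ≤ 0)}

end LinearSystems

/-- A conical basis (a set of extreme directions) of a cone `C`: a finite set of vectors whose
conical combinations are exactly the elements of `C`. -/
def IsConicalBasis {ι : Type*} (C : Set (ι → ℝ)) (E : Finset (ι → ℝ)) : Prop :=
  C = {p | ∃ w : (ι → ℝ) → ℝ, (∀ e ∈ E, 0 ≤ w e) ∧ p = ∑ e ∈ E, w e • e}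

section LinearSystems

variable {ι κ : Type*}

/-- The cone generated by a finite set of vectors. -/
def coneHull (E : Finset (ι → ℝ)) : Set (ι → ℝ) :=
  {p | ∃ w : (ι → ℝ) → ℝ, (∀ e ∈ E, 0 ≤ w e) ∧ p = ∑ e ∈ E, w e • e}

theorem zero_mem_coneHull (E : Finset (ι → ℝ)) : 0 ∈ coneHull E :=
  ⟨0, by simp, by simp⟩

theorem add_mem_coneHull {E : Finset (ι → ℝ)} {p q : ι → ℝ} (hp : p ∈ coneHull E)
    (hq : q ∈ coneHull E) : p + q ∈ coneHull E := by
  obtain ⟨v, hv, rfl⟩ := hp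
  obtain ⟨w, hw, rfl⟩ := hq
  refine ⟨v + w, fun e he => add_nonneg (hv e he) (hw e he), ?_⟩
  simp [add_smul, Finset.sum_add_distrib]

theorem smul_mem_coneHull {E : Finset (ι → ℝ)} {p : ι → ℝ} (hp : p ∈ coneHull E) {t : ℝ}
    (ht : 0 ≤ t) : t • p ∈ coneHull E := by
  obtain ⟨v, hv, rfl⟩ := hp
  refine ⟨t • v, fun e he => mul_nonneg ht (hv e he), ?_⟩
  simp [mul_smul, Finset.smul_sum]

theorem sum_mem_coneHull {α : Type*} {E : Finset (ι → ℝ)} (s : Finset α) {f : α → ι → ℝ}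
    (h : ∀ a ∈ s, f a ∈ coneHull E) : ∑ a ∈ s, f a ∈ coneHull E := by
  classical
  induction s using Finset.induction_on with
  | empty => simpa using zero_mem_coneHull E
  | insert a s ha ih =>
    rw [Finset.sum_insert ha]
    exact add_mem_coneHull (h a (by simp)) (ih fun b hb => h b (by simp [hb]))

theorem subset_coneHull {E : Finset (ι → ℝ)} {e : ι → ℝ} (he : e ∈ E) : e ∈ coneHull E := by
  classical
  refine ⟨Pi.single e 1, fun d _ => ?_, ?_⟩
  · by_cases h : d = e
    · subst h; simp
    · simp [h]
  · rw [Finset.sum_eq_single e]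
    · simp
    · intro d _ hd; simp [hd]
    · exact fun h => absurd he h

open Classical in
/-- The generators of the intersection of a finitely generated cone with a half space. -/
noncomputable def halfspaceGenerators (φ : (ι → ℝ) →ₗ[ℝ] ℝ) (E : Finset (ι → ℝ)) :
    Finset (ι → ℝ) :=
  E.filter (fun e => 0 ≤ φ e) ∪
    Finset.image₂ (fun u v => φ u • v - φ v • u) (E.filter fun e => 0 ≤ φ e)
      (E.filter fun e => ¬ 0 ≤ φ e)

theorem mem_halfspaceGenerators {φ : (ι → ℝ) →ₗ[ℝ] ℝ} {E : Finset (ι → ℝ)} {e : ι → ℝ} :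
    e ∈ halfspaceGenerators φ E ↔ (e ∈ E ∧ 0 ≤ φ e) ∨
      ∃ u ∈ E, ∃ v ∈ E, 0 ≤ φ u ∧ φ v < 0 ∧ φ u • v - φ v • u = e := by
  simp only [halfspaceGenerators, Finset.mem_union, Finset.mem_filter, Finset.mem_image₂, not_le]
  constructor
  · rintro (h | ⟨u, hu, v, hv, h⟩)
    · exact Or.inl h
    · exact Or.inr ⟨u, hu.1, v, hv.1, hu.2, hv.2, h⟩
  · rintro (h | ⟨u, hu, v, hv, hu', hv', h⟩)
    · exact Or.inl h
    · exact Or.inr ⟨u, ⟨hu, hu'⟩, v, ⟨hv, hv'⟩, h⟩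

theorem coneHull_halfspaceGenerators (φ : (ι → ℝ) →ₗ[ℝ] ℝ) (E : Finset (ι → ℝ)) :
    coneHull (halfspaceGenerators φ E) = {p | p ∈ coneHull E ∧ 0 ≤ φ p} := by
  classical
  ext p
  constructor
  · rintro ⟨w, hw, rfl⟩
    have key : ∀ e ∈ halfspaceGenerators φ E, e ∈ coneHull E ∧ 0 ≤ φ e := by
      intro e he
      rcases mem_halfspaceGenerators.1 he with he | ⟨u, hu, v, hv, hu', hv', rfl⟩
      · exact ⟨subset_coneHull he.1, he.2⟩
      · refine ⟨?_, by simp [mul_comm]⟩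
        rw [sub_eq_add_neg, ← neg_smul]
        exact add_mem_coneHull (smul_mem_coneHull (subset_coneHull hv) hu')
          (smul_mem_coneHull (subset_coneHull hu) (by linarith))
    refine ⟨sum_mem_coneHull _ fun e he => smul_mem_coneHull (key e he).1 (hw e he), ?_⟩
    simp only [map_sum, map_smul, smul_eq_mul]
    exact Finset.sum_nonneg fun e he => mul_nonneg (hw e he) (key e he).2
  · rintro ⟨⟨w, hw, rfl⟩, hφ⟩
    set U := E.filter fun e => 0 ≤ φ e with hU
    set V := E.filter fun e => ¬ 0 ≤ φ e with hV
    have hUm : ∀ u ∈ U, 0 ≤ w u ∧ 0 ≤ φ u ∧ u ∈ coneHull (halfspaceGenerators φ E) := by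
      intro u hu
      have hu' := Finset.mem_filter.1 hu
      exact ⟨hw u hu'.1, hu'.2, subset_coneHull (mem_halfspaceGenerators.2 (Or.inl hu'))⟩
    have hVm : ∀ v ∈ V, 0 ≤ w v ∧ φ v < 0 := by
      intro v hv
      have hv' := Finset.mem_filter.1 hv
      exact ⟨hw v hv'.1, not_le.1 hv'.2⟩
    set P := ∑ u ∈ U, w u * φ u with hP
    set N := ∑ v ∈ V, w v * (-φ v) with hN
    have hsplit : ∑ e ∈ E, w e • e = ∑ u ∈ U, w u • u + ∑ v ∈ V, w v • v :=
      (Finset.sum_filter_add_sum_filter_not E _ _).symm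
    have hPN : N ≤ P := by
      rw [hsplit] at hφ
      simp only [map_add, map_sum, map_smul, smul_eq_mul] at hφ
      simp only [hN, hP, mul_neg, Finset.sum_neg_distrib]
      linarith
    have hN0 : 0 ≤ N := Finset.sum_nonneg fun v hv =>
      mul_nonneg (hVm v hv).1 (by linarith [(hVm v hv).2])
    rw [hsplit]
    rcases hN0.eq_or_lt with h0 | hpos
    · have hz : ∀ v ∈ V, w v = 0 := by
        intro v hv
        have h1 := (Finset.sum_eq_zero_iff_of_nonneg (fun v hv =>
          mul_nonneg (hVm v hv).1 (by linarith [(hVm v hv).2]))).1 h0.symm v hv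
        rcases mul_eq_zero.1 h1 with h | h
        · exact h
        · linarith [(hVm v hv).2]
      rw [Finset.sum_eq_zero (s := V) fun v hv => by rw [hz v hv, zero_smul], add_zero]
      exact sum_mem_coneHull _ fun u hu => smul_mem_coneHull (hUm u hu).2.2 (hUm u hu).1
    · have hPpos : 0 < P := hpos.trans_le hPN
      have hVsum : ∑ u ∈ U, ∑ v ∈ V, (w u * w v / P) • (φ u • v - φ v • u)
          = ∑ v ∈ V, w v • v + (N / P) • ∑ u ∈ U, w u • u := by
        have h1 : ∑ u ∈ U, ∑ v ∈ V, (w u * w v / P) • (φ u • v) = ∑ v ∈ V, w v • v := by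
          rw [Finset.sum_comm]
          refine Finset.sum_congr rfl fun v _ => ?_
          simp only [smul_smul]
          rw [← Finset.sum_smul]
          congr 1
          calc ∑ u ∈ U, w u * w v / P * φ u = ∑ u ∈ U, (w u * φ u) * (w v / P) :=
                Finset.sum_congr rfl fun u _ => by ring
            _ = w v := by rw [← Finset.sum_mul, ← hP]; field_simp
        have h2 : ∑ u ∈ U, ∑ v ∈ V, (w u * w v / P) • (φ v • u)
            = -((N / P) • ∑ u ∈ U, w u • u) := by
          rw [Finset.smul_sum, ← Finset.sum_neg_distrib]
          refine Finset.sum_congr rfl fun u _ => ?_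
          simp only [smul_smul]
          rw [← Finset.sum_smul, ← neg_smul]
          congr 1
          calc ∑ v ∈ V, w u * w v / P * φ v = ∑ v ∈ V, (w v * (-φ v)) * (-(w u / P)) :=
                Finset.sum_congr rfl fun u _ => by ring
            _ = _ := by rw [← Finset.sum_mul, ← hN]; ring
        simp only [smul_sub, Finset.sum_sub_distrib]
        rw [h1, h2, sub_neg_eq_add]
      have hfin : ∑ u ∈ U, w u • u + ∑ v ∈ V, w v • v = (1 - N / P) • ∑ u ∈ U, w u • u +
          ∑ u ∈ U, ∑ v ∈ V, (w u * w v / P) • (φ u • v - φ v • u) := by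
        rw [hVsum, sub_smul, one_smul]; abel
      rw [hfin]
      refine add_mem_coneHull (smul_mem_coneHull (sum_mem_coneHull _ fun u hu =>
        smul_mem_coneHull (hUm u hu).2.2 (hUm u hu).1) ?_) ?_
      · rw [sub_nonneg, div_le_one hPpos]; exact hPN
      · refine sum_mem_coneHull _ fun u hu => sum_mem_coneHull _ fun v hv =>
          smul_mem_coneHull (subset_coneHull ?_) ?_
        · exact mem_halfspaceGenerators.2 (Or.inr ⟨u, (Finset.mem_filter.1 hu).1, v,
            (Finset.mem_filter.1 hv).1, (hUm u hu).2.1, (hVm v hv).2, rfl⟩)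
        · exact div_nonneg (mul_nonneg (hUm u hu).1 (hVm v hv).1) hPpos.le

variable [Fintype ι]

/-- A cone defined by finitely many integer inequalities has a finite set of integer generators. -/
theorem exists_integral_generators (L : List (ι → ℤ)) :
    ∃ E : Finset (ι → ℝ), coneHull E = {p | ∀ a ∈ L, 0 ≤ ∑ i, (a i : ℝ) * p i} ∧
      ∀ e ∈ E, ∀ i, ∃ z : ℤ, e i = (z : ℝ) := by
  classical
  induction L with
  | nil =>
    refine ⟨Finset.univ.image (fun i : ι => (Pi.single i 1 : ι → ℝ)) ∪
      Finset.univ.image (fun i : ι => (-Pi.single i 1 : ι → ℝ)), ?_, ?_⟩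
    · ext p
      simp only [List.not_mem_nil, false_implies, implies_true, Set.mem_ofPred_eq, iff_true]
      have hp : p = ∑ i, p i • (Pi.single i 1 : ι → ℝ) := by
        ext j; simp [Finset.sum_apply, Pi.single_apply]
      rw [hp]
      refine sum_mem_coneHull _ fun i _ => ?_
      rcases le_total 0 (p i) with h | h
      · exact smul_mem_coneHull (subset_coneHull (by simp)) h
      · rw [← neg_smul_neg]
        exact smul_mem_coneHull (subset_coneHull (by simp)) (by linarith)
    · intro e he j
      simp only [Finset.mem_union, Finset.mem_image, Finset.mem_univ, true_and] at he
      rcases he with ⟨i, rfl⟩ | ⟨i, rfl⟩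
      · exact ⟨(Pi.single i 1 : ι → ℤ) j, by by_cases h : j = i <;> simp [h]⟩
      · exact ⟨-(Pi.single i 1 : ι → ℤ) j, by by_cases h : j = i <;> simp [h]⟩
  | cons a L ih =>
    obtain ⟨E, hE, hint⟩ := ih
    let φ : (ι → ℝ) →ₗ[ℝ] ℝ := ∑ i, (a i : ℝ) • LinearMap.proj i
    have hφ : ∀ p, φ p = ∑ i, (a i : ℝ) * p i := fun p => by simp [φ]
    have hφint : ∀ e ∈ E, ∃ z : ℤ, φ e = z := by
      intro e he
      choose z hz using hint e he
      exact ⟨∑ i, a i * z i, by simp [hφ, hz]⟩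
    refine ⟨halfspaceGenerators φ E, ?_, ?_⟩
    · rw [coneHull_halfspaceGenerators, hE]
      ext p
      simp [hφ, and_comm]
    · intro e he
      rcases mem_halfspaceGenerators.1 he with he | ⟨u, hu, v, hv, -, -, rfl⟩
      · exact hint e he.1
      · obtain ⟨s, hs⟩ := hφint u hu
        obtain ⟨t, ht⟩ := hφint v hv
        intro i
        obtain ⟨x, hx⟩ := hint u hu i
        obtain ⟨y, hy⟩ := hint v hv i
        exact ⟨s * y - t * x, by simp [hs, ht, hx, hy]⟩

theorem exists_integral_conicalBasis [Fintype κ] (A : Matrix ι κ ℝ) (b : ι → EReal)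
    (hA : ∀ i j, ∃ z : ℤ, A i j = z) :
    ∃ E : Finset (ι → ℝ), IsConicalBasis (systemCone A b) E ∧ ∀ e ∈ E, ∀ i, ∃ z : ℤ, e i = (z : ℝ) := by
  classical
  choose Z hZ using hA
  obtain ⟨E, hE, hint⟩ := exists_integral_generators
    ((Finset.univ : Finset κ).toList.map (fun j i => Z i j) ++
      (Finset.univ : Finset κ).toList.map (fun j i => -Z i j) ++
      ((Finset.univ.filter fun i => b i = ⊤).toList.map fun i => (Pi.single i 1 : ι → ℤ)) ++
      ((Finset.univ.filter fun i => b i = ⊥).toList.map fun i => (-Pi.single i 1 : ι → ℤ)))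
  refine ⟨E, ?_, hint⟩
  change _ = coneHull E
  rw [hE]
  ext p
  have hsingle : ∀ i, ∑ x, ((Pi.single i 1 : ι → ℤ) x : ℝ) * p x = p i := by
    intro i
    rw [Finset.sum_eq_single i] <;> simp +contextual
  have hcol : ∀ j, ∑ x, (Z x j : ℝ) * p x = Matrix.vecMul p A j := by
    intro j
    simp [Matrix.vecMul, dotProduct, hZ, mul_comm]
  simp only [systemCone, Set.mem_ofPred_eq, List.mem_append, List.mem_map, Finset.mem_toList,
    Finset.mem_univ, true_and, Finset.mem_filter, or_imp, forall_and, forall_exists_index,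
    forall_apply_eq_imp_iff, and_imp, forall_apply_eq_imp_iff₂, Int.cast_neg, neg_mul,
    Finset.sum_neg_distrib, hcol, hsingle, Pi.neg_apply, Left.nonneg_neg_iff, and_assoc]
  rw [← and_assoc (b := ∀ j, _ ≤ (0 : ℝ)), ← forall_and]
  simp only [le_antisymm_iff, and_comm]
  exact Iff.rfl

end LinearSystems

section LinearSystems

variable {ι κ : Type*}

theorem mul_ne_bot_of_mem_systemCone [Fintype ι] {A : Matrix ι κ ℝ} {b : ι → EReal} {p : ι → ℝ}
    (hp : p ∈ systemCone A b) {i : ι} (hi : p i ≠ 0) : (p i : EReal) * b i ≠ ⊥ := by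
  obtain ⟨-, h1, h2⟩ := hp
  have h1 := h1 i
  have h2 := h2 i
  induction hb : b i with
  | bot =>
    rw [EReal.coe_mul_bot_of_neg (lt_of_le_of_ne (h2 hb) hi)]
    simp
  | coe x => rw [← EReal.coe_mul]; exact EReal.coe_ne_bot _
  | top =>
    rw [EReal.coe_mul_top_of_pos (lt_of_le_of_ne (h1 hb) hi.symm)]
    simp

theorem EReal.sum_ne_bot {α : Type*} {s : Finset α} {f : α → EReal} (h : ∀ a ∈ s, f a ≠ ⊥) :
    ∑ a ∈ s, f a ≠ ⊥ := by
  classical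
  induction s using Finset.induction_on with
  | empty => simp
  | insert a s ha ih =>
    rw [Finset.sum_insert ha]
    rw [Ne, EReal.add_eq_bot_iff, not_or]
    exact ⟨h a (by simp), ih fun b hb => h b (by simp [hb])⟩

theorem EReal.coe_finset_sum {α : Type*} (s : Finset α) (f : α → ℝ) :
    ((∑ a ∈ s, f a : ℝ) : EReal) = ∑ a ∈ s, (f a : EReal) := by
  classical
  induction s using Finset.induction_on with
  | empty => simp
  | insert a s ha ih => rw [Finset.sum_insert ha, Finset.sum_insert ha, EReal.coe_add, ih]

/-- Sums of convergent sequences of extended reals converge if no limit is `⊥`. -/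
theorem EReal.tendsto_finset_sum {α β : Type*} {l : Filter β} {s : Finset α} {f : α → β → EReal}
    {c : α → EReal} (hf : ∀ a ∈ s, Tendsto (f a) l (𝓝 (c a))) (hc : ∀ a ∈ s, c a ≠ ⊥) :
    Tendsto (fun x => ∑ a ∈ s, f a x) l (𝓝 (∑ a ∈ s, c a)) := by
  classical
  induction s using Finset.induction_on with
  | empty => simpa using tendsto_const_nhds
  | insert a s ha ih =>
    simp only [Finset.sum_insert ha]
    have h1 := hf a (by simp)
    have h2 := ih (fun b hb => hf b (by simp [hb])) (fun b hb => hc b (by simp [hb]))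
    have hs : ∑ b ∈ s, c b ≠ ⊥ := EReal.sum_ne_bot fun b hb => hc b (by simp [hb])
    exact (EReal.continuousAt_add (p := (c a, ∑ b ∈ s, c b)) (Or.inr hs)
      (Or.inl (hc a (by simp)))).tendsto.comp (h1.prodMk_nhds h2)

/-- The support of `p` consists of rows with a finite right-hand side, and `p` annihilates the
right-hand side. -/
def FiniteAnnihilating [Fintype ι] (b : ι → EReal) (p : ι → ℝ) : Prop :=
  (∀ i, p i ≠ 0 → b i ≠ ⊤ ∧ b i ≠ ⊥) ∧ ∑ i, p i * (b i).toReal = 0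

variable [Fintype ι]

theorem sumZeroOrIllDefined_iff_finiteAnnihilating {A : Matrix ι κ ℝ} {b : ι → EReal}
    {p : ι → ℝ} (hp : p ∈ systemCone A b) :
    SumZeroOrIllDefined b p ↔ FiniteAnnihilating b p := by
  classical
  have hill : ¬ SumIllDefined b p := fun ⟨_, j, hj, hj'⟩ => mul_ne_bot_of_mem_systemCone hp hj hj'
  have hsum : (∀ i, p i ≠ 0 → b i ≠ ⊤ ∧ b i ≠ ⊥) →
      ∑ i ∈ Finset.univ.filter (fun i => p i ≠ 0), (p i : EReal) * b i
        = ((∑ i, p i * (b i).toReal : ℝ) : EReal) := by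
    intro h
    rw [← Finset.sum_filter_add_sum_filter_not Finset.univ (fun i => p i ≠ 0)
      (fun i => p i * (b i).toReal), Finset.sum_eq_zero (s := Finset.univ.filter fun i => ¬ p i ≠ 0),
      add_zero, EReal.coe_finset_sum]
    · refine Finset.sum_congr rfl fun i hi => ?_
      have := h i (Finset.mem_filter.1 hi).2
      rw [EReal.coe_mul, EReal.coe_toReal this.1 this.2]
    · intro i hi
      have := (Finset.mem_filter.1 hi).2
      rw [not_not.1 this, zero_mul]
  constructor
  · rintro (⟨-, h⟩ | h)
    · have hfin : ∀ i, p i ≠ 0 → b i ≠ ⊤ ∧ b i ≠ ⊥ := by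
        intro i hi
        have hi' : i ∈ Finset.univ.filter (fun i => p i ≠ 0) := by simpa using hi
        by_contra hb
        have htop : (p i : EReal) * b i = ⊤ := by
          by_cases hb1 : b i = ⊤
          · rw [hb1, EReal.coe_mul_top_of_pos (lt_of_le_of_ne (hp.2.1 i hb1) hi.symm)]
          · have hb2 : b i = ⊥ := by
              by_contra hb2; exact hb ⟨hb1, hb2⟩
            rw [hb2, EReal.coe_mul_bot_of_neg (lt_of_le_of_ne (hp.2.2 i hb2) hi)]
        rw [← Finset.add_sum_erase _ _ hi', htop, EReal.top_add_of_ne_bot] at h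
        · exact EReal.top_ne_zero h
        · refine EReal.sum_ne_bot fun j hj => mul_ne_bot_of_mem_systemCone hp ?_
          simpa using (Finset.mem_filter.1 (Finset.mem_of_mem_erase hj)).2
      refine ⟨hfin, ?_⟩
      rw [hsum hfin] at h
      exact_mod_cast h
    · exact absurd h hill
  · rintro ⟨hfin, h⟩
    refine Or.inl ⟨hill, ?_⟩
    rw [hsum hfin, h, EReal.coe_zero]

theorem FiniteAnnihilating.sum {b : ι → EReal} {E : Finset (ι → ℝ)}
    (h : ∀ e ∈ E, FiniteAnnihilating b e) (w : (ι → ℝ) → ℝ) :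
    FiniteAnnihilating b (∑ e ∈ E, w e • e) := by
  constructor
  · intro i hi
    rw [Finset.sum_apply] at hi
    obtain ⟨e, he, hne⟩ := Finset.exists_ne_zero_of_sum_ne_zero hi
    exact (h e he).1 i fun h0 => hne (by simp [h0])
  · simp only [Finset.sum_apply, Finset.sum_mul, Pi.smul_apply, smul_eq_mul]
    rw [Finset.sum_comm]
    refine Finset.sum_eq_zero fun e he => ?_
    simp only [mul_assoc]
    rw [← Finset.mul_sum, (h e he).2, mul_zero]

theorem IsConicalBasis.forall_sumZeroOrIllDefined_iff {A : Matrix ι κ ℝ} {b : ι → EReal}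
    {E : Finset (ι → ℝ)} (hE : IsConicalBasis (systemCone A b) E) :
    (∀ p ∈ E, SumZeroOrIllDefined b p) ↔ ∀ p ∈ systemCone A b, FiniteAnnihilating b p := by
  have hsub : ∀ p ∈ E, p ∈ systemCone A b := fun p hp => by
    rw [hE]; exact subset_coneHull hp
  constructor
  · intro h p hp
    have hp' : p ∈ coneHull E := by rw [← show systemCone A b = coneHull E from hE]; exact hp
    obtain ⟨w, -, rfl⟩ := hp'
    exact FiniteAnnihilating.sum
      (fun e he => (sumZeroOrIllDefined_iff_finiteAnnihilating (hsub e he)).1 (h e he)) w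
  · exact fun h p hp => (sumZeroOrIllDefined_iff_finiteAnnihilating (hsub p hp)).2 (h p (hsub p hp))

/-- The extended-real system `A x = b` can be solved in the limit. -/
def LimitSolvable [Fintype κ] (A : Matrix ι κ ℝ) (b : ι → EReal) : Prop :=
  ∃ x : ℕ → κ → ℝ, ∀ i, Tendsto (fun n => ((A.mulVec (x n) i : ℝ) : EReal)) atTop (𝓝 (b i))

variable [Fintype κ]

theorem LimitSolvable.finiteAnnihilating {A : Matrix ι κ ℝ} {b : ι → EReal}
    (h : LimitSolvable A b) {p : ι → ℝ} (hp : p ∈ systemCone A b) : FiniteAnnihilating b p := by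
  classical
  rw [← sumZeroOrIllDefined_iff_finiteAnnihilating hp]
  obtain ⟨x, hx⟩ := h
  refine Or.inl ⟨fun ⟨_, j, hj, hj'⟩ => mul_ne_bot_of_mem_systemCone hp hj hj', ?_⟩
  have hlim : Tendsto (fun n => ∑ i ∈ Finset.univ.filter (fun i => p i ≠ 0),
      (p i : EReal) * (A.mulVec (x n) i : ℝ)) atTop
      (𝓝 (∑ i ∈ Finset.univ.filter (fun i => p i ≠ 0), (p i : EReal) * b i)) := by
    refine EReal.tendsto_finset_sum (fun i hi => ?_) fun i hi =>
      mul_ne_bot_of_mem_systemCone hp (Finset.mem_filter.1 hi).2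
    have hpi : (p i : EReal) ≠ 0 := by
      exact_mod_cast (Finset.mem_filter.1 hi).2
    exact (EReal.tendsto_mul (Or.inl hpi) (Or.inl hpi) (Or.inl (EReal.coe_ne_bot _))
      (Or.inl (EReal.coe_ne_top _))).comp (tendsto_const_nhds.prodMk_nhds (hx i))
  have hzero : ∀ n, ∑ i ∈ Finset.univ.filter (fun i => p i ≠ 0),
      (p i : EReal) * (A.mulVec (x n) i : ℝ) = 0 := by
    intro n
    have h1 : ∑ i ∈ Finset.univ.filter (fun i => p i ≠ 0), p i * A.mulVec (x n) i = 0 := by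
      rw [Finset.sum_filter_of_ne (p := fun i => p i ≠ 0) fun i _ hi h0 => hi (by rw [h0, zero_mul])]
      change p ⬝ᵥ A.mulVec (x n) = 0
      rw [Matrix.dotProduct_mulVec, hp.1, zero_dotProduct]
    simp only [← EReal.coe_mul]
    rw [← EReal.coe_finset_sum, h1, EReal.coe_zero]
  simp only [hzero] at hlim
  exact tendsto_nhds_unique hlim tendsto_const_nhds |>.symm ▸ rfl

theorem dual_pi_apply [DecidableEq ι] (f : (ι → ℝ) →ₗ[ℝ] ℝ) (z : ι → ℝ) :
    f z = ∑ i, f (Pi.single i 1) * z i := by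
  conv_lhs => rw [← Finset.univ_sum_single z]
  rw [map_sum]
  refine Finset.sum_congr rfl fun i _ => ?_
  rw [mul_comm, ← smul_eq_mul, ← map_smul, ← Pi.single_smul, smul_eq_mul, mul_one]

/-- Fredholm alternative. -/
theorem exists_mulVec_eq_of_forall_vecMul_eq_zero (A : Matrix ι κ ℝ) (b : ι → ℝ)
    (h : ∀ p : ι → ℝ, Matrix.vecMul p A = 0 → p ⬝ᵥ b = 0) : ∃ x, A.mulVec x = b := by
  classical
  by_contra hx
  have hb : b ∉ LinearMap.range A.mulVecLin := fun ⟨x, hx'⟩ => hx ⟨x, hx'⟩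
  obtain ⟨f, hf, hle⟩ := Submodule.exists_le_ker_of_notMem hb
  have hker : ∀ x, f (A.mulVec x) = 0 := fun x => hle ⟨x, rfl⟩
  have hfp : ∀ z, f z = (fun i => f (Pi.single i 1)) ⬝ᵥ z := fun z => dual_pi_apply f z
  refine hf ?_
  rw [hfp]
  refine h _ (dotProduct_eq_zero _ fun x => ?_)
  rw [← Matrix.dotProduct_mulVec, ← hfp, hker]

/-- Gordan's alternative relative to a linear system. -/
theorem exists_mulVec_pos (A : Matrix ι κ ℝ) (F : Set ι) (s : ι → ℝ) (hs : ∀ i, s i * s i = 1)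
    (h : ∀ p : ι → ℝ, Matrix.vecMul p A = 0 → (∀ i ∉ F, 0 ≤ s i * p i) → ∀ i ∉ F, p i = 0) :
    ∃ y, (∀ i ∈ F, A.mulVec y i = 0) ∧ ∀ i ∉ F, 0 < s i * A.mulVec y i := by
  classical
  let U : Set (ι → ℝ) := {z | ∀ i ∉ F, 0 < s i * z i}
  let W : Set (ι → ℝ) := {z | ∃ y, (∀ i ∈ F, A.mulVec y i = 0) ∧ ∀ i ∉ F, z i = A.mulVec y i}
  by_contra hno
  have hdisj : Disjoint U W := by
    rw [Set.disjoint_left]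
    rintro z hz ⟨y, hy, hzy⟩
    exact hno ⟨y, hy, fun i hi => by rw [← hzy i hi]; exact hz i hi⟩
  have hUopen : IsOpen U := by
    have : U = ⋂ i, {z | i ∉ F → 0 < s i * z i} := by ext z; simp [U]
    rw [this]
    refine isOpen_iInter_of_finite fun i => ?_
    by_cases hi : i ∈ F
    · simp [hi]
    · simp only [hi, not_false_eq_true, true_implies]
      exact isOpen_lt continuous_const (continuous_const.mul (continuous_apply i))
  have hUconv : Convex ℝ U := by
    intro z hz z' hz' a c ha hc hac i hi
    have h1 := hz i hi
    have h2 := hz' i hi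
    have h3 : s i * (a • z + c • z') i = a * (s i * z i) + c * (s i * z' i) := by
      simp only [Pi.add_apply, Pi.smul_apply, smul_eq_mul]; ring
    rw [h3]
    rcases ha.eq_or_lt with rfl | ha
    · have : c = 1 := by linarith
      subst this; simpa using h2
    · have := mul_pos ha h1
      have := mul_nonneg hc h2.le
      linarith
  have hWsmul : ∀ z ∈ W, ∀ t : ℝ, t • z ∈ W := by
    rintro z ⟨y, hy, hzy⟩ t
    refine ⟨t • y, fun i hi => ?_, fun i hi => ?_⟩
    · rw [Matrix.mulVec_smul, Pi.smul_apply, hy i hi, smul_zero]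
    · rw [Matrix.mulVec_smul, Pi.smul_apply, Pi.smul_apply, hzy i hi]
  have hWconv : Convex ℝ W := by
    rintro z ⟨y, hy, hzy⟩ z' ⟨y', hy', hzy'⟩ a c - - -
    refine ⟨a • y + c • y', fun i hi => ?_, fun i hi => ?_⟩
    · simp [Matrix.mulVec_add, Matrix.mulVec_smul, hy i hi, hy' i hi]
    · simp [Matrix.mulVec_add, Matrix.mulVec_smul, hzy i hi, hzy' i hi]
  obtain ⟨f, u, hfU, hfW⟩ := geometric_hahn_banach_open hUconv hUopen hWconv hdisj
  have hu : u ≤ 0 := by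
    simpa using hfW 0 ⟨0, by simp, by simp⟩
  have hfW0 : ∀ z ∈ W, f z = 0 := by
    intro z hz
    by_contra hne
    have := hfW _ (hWsmul z hz ((u - 1) / f z))
    rw [map_smul, smul_eq_mul, div_mul_cancel₀ _ hne] at this
    linarith
  set q : ι → ℝ := fun i => f (Pi.single i 1) with hq
  have hfq : ∀ z, f z = q ⬝ᵥ z := fun z => dual_pi_apply (f : (ι → ℝ) →ₗ[ℝ] ℝ) z
  have hsU : s ∈ U := fun i _ => by rw [hs i]; exact one_pos
  have hfs : f s < 0 := (hfU s hsU).trans_le hu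
  have hqF : ∀ i ∈ F, q i = 0 := by
    intro i hi
    refine hfW0 _ ⟨0, by simp, fun j hj => ?_⟩
    have : j ≠ i := fun h => hj (h ▸ hi)
    simp [this]
  have hqsign : ∀ i ∉ F, s i * q i ≤ 0 := by
    intro i hi
    by_contra hpos
    rw [not_le] at hpos
    have ht : 0 ≤ -f s / (s i * q i) := div_nonneg (by linarith) hpos.le
    have hz : s + (-f s / (s i * q i)) • Pi.single i (s i) ∈ U := by
      intro j _
      by_cases hj : j = i
      · subst hj
        simp only [Pi.add_apply, Pi.smul_apply, Pi.single_eq_same, smul_eq_mul]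
        have : s j * (s j + -f s / (s j * q j) * s j) = (1 + -f s / (s j * q j)) * (s j * s j) := by
          ring
        rw [this, hs j]
        linarith
      · simp [hj, hs j]
    have := hfU _ hz
    have h1 : f (Pi.single i (s i)) = s i * q i := by
      rw [hfq, dotProduct_single, mul_comm]
    rw [map_add, map_smul, smul_eq_mul, h1, div_mul_cancel₀ _ hpos.ne'] at this
    linarith
  let B : Matrix ι κ ℝ := Matrix.of fun i j => if i ∈ F then A i j else 0
  obtain ⟨r, hr⟩ := exists_mulVec_eq_of_forall_vecMul_eq_zero B.transpose (Matrix.vecMul q A) (by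
    intro y hy
    rw [Matrix.vecMul_transpose] at hy
    rw [dotProduct_comm, ← Matrix.dotProduct_mulVec, ← hfq]
    refine hfW0 _ ⟨y, fun i hi => ?_, fun _ _ => rfl⟩
    have := congrFun hy i
    simpa [Matrix.mulVec, dotProduct, B, hi] using this)
  rw [Matrix.mulVec_transpose] at hr
  let p : ι → ℝ := fun i => if i ∈ F then r i else -q i
  have hp : Matrix.vecMul p A = 0 := by
    ext j
    have h1 := congrFun hr j
    simp only [Matrix.vecMul, dotProduct, B, Matrix.of_apply, p, Pi.zero_apply] at h1 ⊢
    rw [← sub_eq_zero, ← Finset.sum_sub_distrib] at h1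
    rw [← h1]
    refine Finset.sum_congr rfl fun i _ => ?_
    by_cases hi : i ∈ F
    · simp [hi, hqF i hi]
    · simp [hi]
  have hp0 := h p hp fun i hi => by
    simp only [p, hi, if_false, mul_neg]
    linarith [hqsign i hi]
  have hq0 : q = 0 := by
    ext i
    by_cases hi : i ∈ F
    · exact hqF i hi
    · simpa [p, hi] using hp0 i hi
  rw [hfq, hq0, zero_dotProduct] at hfs
  exact lt_irrefl _ hfs

theorem limitSolvable_of_finiteAnnihilating {A : Matrix ι κ ℝ} {b : ι → EReal}
    (h : ∀ p ∈ systemCone A b, FiniteAnnihilating b p) : LimitSolvable A b := by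
  classical
  let F : Set ι := {i | b i ≠ ⊤ ∧ b i ≠ ⊥}
  let B : Matrix ι κ ℝ := Matrix.of fun i j => if i ∈ F then A i j else 0
  obtain ⟨x, hx⟩ := exists_mulVec_eq_of_forall_vecMul_eq_zero B
    (fun i => if i ∈ F then (b i).toReal else 0) (by
    intro p hp
    have hmem : (fun i => if i ∈ F then p i else 0) ∈ systemCone A b := by
      refine ⟨?_, fun i hi => ?_, fun i hi => ?_⟩
      · rw [← hp]
        ext j
        simp [Matrix.vecMul, dotProduct, B]
      · simp [F, hi]
      · simp [F, hi]
    refine Eq.trans ?_ (h _ hmem).2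
    simp [dotProduct])
  let s : ι → ℝ := fun i => if b i = ⊤ then 1 else -1
  obtain ⟨y, hyF, hy⟩ := exists_mulVec_pos A F s (fun i => by by_cases hi : b i = ⊤ <;> simp [s, hi])
    (by
    intro p hp hsign i hi
    have hmem : p ∈ systemCone A b := by
      refine ⟨hp, fun j hj => ?_, fun j hj => ?_⟩
      · simpa [s, hj] using hsign j fun h => h.1 hj
      · simpa [s, hj] using hsign j fun h => h.2 hj
    by_contra hne
    exact hi ((h p hmem).1 i hne))
  refine ⟨fun n => x + (n : ℝ) • y, fun i => ?_⟩
  simp only [Matrix.mulVec_add, Matrix.mulVec_smul, Pi.add_apply, Pi.smul_apply, smul_eq_mul]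
  by_cases hi : i ∈ F
  · have hxi : A.mulVec x i = (b i).toReal := by
      simpa [Matrix.mulVec, dotProduct, B, hi] using congrFun hx i
    simp only [hyF i hi, mul_zero, add_zero, hxi, EReal.coe_toReal hi.1 hi.2]
    exact tendsto_const_nhds
  · have hyi := hy i hi
    by_cases hb : b i = ⊤
    · simp only [s, hb, if_true, one_mul] at hyi
      rw [hb, EReal.tendsto_coe_nhds_top_iff]
      exact tendsto_atTop_add_const_left _ _
        (tendsto_natCast_atTop_atTop.atTop_mul_const hyi)
    · have hb' : b i = ⊥ := by
        by_contra hb'; exact hi ⟨hb, hb'⟩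
      simp only [s, hb, if_false, neg_mul, one_mul] at hyi
      rw [hb', EReal.tendsto_coe_nhds_bot_iff]
      exact tendsto_atBot_add_const_left _ _
        (tendsto_natCast_atTop_atTop.atTop_mul_const_of_neg (by linarith))

theorem IsConicalBasis.limitSolvable_iff {A : Matrix ι κ ℝ} {b : ι → EReal}
    {E : Finset (ι → ℝ)} (hE : IsConicalBasis (systemCone A b) E) :
    LimitSolvable A b ↔ ∀ p ∈ E, SumZeroOrIllDefined b p := by
  rw [hE.forall_sumZeroOrIllDefined_iff]
  exact ⟨fun h _ hp => h.finiteAnnihilating hp, limitSolvable_of_finiteAnnihilating⟩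

end LinearSystems

/-- The logarithm of a quotient of convergent positive sequences converges in the extended reals,
if the limit of the quotient is well defined. -/
theorem tendsto_coe_log_sub_log {f g : ℕ → ℝ} {a c : ℝ} (hf : ∀ n, 0 < f n) (hg : ∀ n, 0 < g n)
    (hfa : Tendsto f atTop (𝓝 a)) (hgc : Tendsto g atTop (𝓝 c)) (hac : 0 < a ∨ 0 < c) :
    Tendsto (fun n => ((Real.log (f n) - Real.log (g n) : ℝ) : EReal)) atTop
      (𝓝 (ENNReal.log (ENNReal.ofReal a) - ENNReal.log (ENNReal.ofReal c))) := by
  have key : ∀ {f : ℕ → ℝ} {a : ℝ}, Tendsto f atTop (𝓝 a) →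
      Tendsto (fun n => ENNReal.log (ENNReal.ofReal (f n))) atTop
        (𝓝 (ENNReal.log (ENNReal.ofReal a))) := fun h =>
    (ENNReal.continuous_log.tendsto _).comp ((ENNReal.continuous_ofReal.tendsto _).comp h)
  have h1 := (key hfa).prodMk_nhds ((continuous_neg.tendsto _).comp (key hgc))
  have h2 := (EReal.continuousAt_add
    (p := (ENNReal.log (ENNReal.ofReal a), -ENNReal.log (ENNReal.ofReal c)))
    (Or.inl (by simp only [ne_eq, ENNReal.log_eq_top_iff, ENNReal.ofReal_ne_top, not_false_eq_true])) (by
      rcases hac with h | h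
      · exact Or.inl (by simpa using h)
      · exact Or.inr (by simpa [EReal.neg_eq_top_iff] using h))).tendsto.comp h1
  rw [← sub_eq_add_neg] at h2
  refine h2.congr fun n => ?_
  simp only [Function.comp_apply, ENNReal.log_ofReal_of_pos (hf n), ENNReal.log_ofReal_of_pos (hg n)]
  rw [← sub_eq_add_neg, EReal.coe_sub]

theorem tendsto_exp_mul_of_tendsto_coe {u : ℕ → ℝ} {a c : ℝ} (ha : 0 ≤ a) (hc : 0 < c)
    (h : Tendsto (fun n => (u n : EReal)) atTop
      (𝓝 (ENNReal.log (ENNReal.ofReal a) - ENNReal.log (ENNReal.ofReal c)))) :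
    Tendsto (fun n => Real.exp (u n) * c) atTop (𝓝 a) := by
  rw [ENNReal.log_ofReal_of_pos hc] at h
  have h1 : Tendsto (fun n => (u n : EReal) + (Real.log c : ℝ)) atTop
      (𝓝 (ENNReal.log (ENNReal.ofReal a))) := by
    have h2 := (EReal.continuousAt_add
      (p := (ENNReal.log (ENNReal.ofReal a) - (Real.log c : ℝ), ((Real.log c : ℝ) : EReal)))
      (Or.inr (EReal.coe_ne_bot _)) (Or.inr (EReal.coe_ne_top _))).tendsto.comp
      (h.prodMk_nhds (tendsto_const_nhds (x := ((Real.log c : ℝ) : EReal))))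
    simpa only [EReal.sub_add_cancel, Function.comp_def] using h2
  have h3 := (ENNReal.tendsto_toReal (a := ENNReal.ofReal a) ENNReal.ofReal_ne_top).comp
    ((by
      simpa only [ENNReal.exp_log] using
        ENNReal.continuous_exp.tendsto (ENNReal.log (ENNReal.ofReal a)) :
      Tendsto EReal.exp (𝓝 (ENNReal.log (ENNReal.ofReal a))) (𝓝 (ENNReal.ofReal a))).comp h1)
  rw [ENNReal.toReal_ofReal ha] at h3
  refine h3.congr fun n => ?_
  simp only [Function.comp_apply]
  rw [← EReal.coe_add, EReal.exp_coe, ENNReal.toReal_ofReal (Real.exp_pos _).le, Real.exp_add,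
    Real.exp_log hc]

theorem List.prod_map_pos {α : Type*} (l : List α) {f : α → ℝ} (hf : ∀ a, 0 < f a) :
    0 < (l.map f).prod := by
  refine List.prod_pos fun y hy => ?_
  obtain ⟨a, -, rfl⟩ := List.mem_map.1 hy
  exact hf a

namespace ExtensiveGame

variable {Player Act : Type*} {G : ExtensiveGame Player Act}

theorem infoOf_eq {h : List Act} (hh : G.IsNonterminal h) {I : G.Info} (hI : h ∈ I.1) :
    infoOf h hh = I :=
  Subtype.ext ((G.info_partition h hh).unique ⟨(infoOf h hh).2, mem_infoOf h hh⟩ ⟨I.2, hI⟩)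

theorem choiceAt_eq {h : G.Hist} {k : Fin h.1.length} {I : G.Info} {a : Action I}
    (hI : h.1.take k ∈ I.1) (ha : h.1.get k = a.1) : choiceAt h k = ⟨I, a⟩ := by
  obtain rfl := infoOf_eq (take_isNonterminal h k) hI
  unfold choiceAt
  congr 1
  exact Subtype.ext ha

theorem exists_mem_choices (c : G.Choice) : ∃ h : G.Hist, c ∈ choices h := by
  obtain ⟨I, a, g, hg, hga⟩ := c
  refine ⟨⟨g ++ [a], hga⟩, ?_⟩
  rw [choices, List.mem_ofFn]
  exact ⟨⟨g.length, by simp⟩, choiceAt_eq (by simpa using hg) (by simp)⟩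

/-- The initial segment of length `m` of a history. -/
def takeHist (h : G.Hist) (m : ℕ) : G.Hist :=
  ⟨h.1.take m, G.prefix_mem _ _ (List.take_prefix _ _) h.2⟩

theorem choices_takeHist (h : G.Hist) (m : ℕ) : choices (takeHist h m) = (choices h).take m := by
  apply List.ext_getElem
  · simp [choices, takeHist]
  · intro k h1 h2
    have hk : k < m ∧ k < h.1.length := by simpa [choices, takeHist] using h1
    simp only [choices, List.getElem_take, List.getElem_ofFn]
    refine choiceAt_eq ?_ ?_
    · have : (takeHist h m).1.take k = h.1.take k := by
        simp [takeHist, List.take_take, hk.1.le]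
      rw [this]
      exact mem_infoOf _ _
    · simp [takeHist]

theorem PerfectRecall.nodup_choices (hG : G.PerfectRecall) (h : G.Hist) : (choices h).Nodup := by
  classical
  rw [choices, List.nodup_ofFn]
  have key : ∀ j k : Fin h.1.length, j < k → choiceAt h j ≠ choiceAt h k := by
    intro j k hjk heq
    set I := (choiceAt h j).1 with hI
    have hj : h.1.take j ∈ I.1 := mem_infoOf _ (take_isNonterminal h j)
    have hk : h.1.take k ∈ I.1 := by
      rw [hI, heq]
      exact mem_infoOf _ (take_isNonterminal h k)
    have hrec : experience (playerAt I) (takeHist h j) = experience (playerAt I) (takeHist h k) :=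
      hG I ⟨_, hj⟩ ⟨_, hk⟩
    unfold experience at hrec
    rw [choices_takeHist, choices_takeHist] at hrec
    have hlen := congrArg List.length hrec
    have hjlen : (j : ℕ) < (choices h).length := by simp [choices]
    have hsub : (choices h).take (j + 1) <+: (choices h).take k :=
      List.take_prefix_take_left (by exact hjk)
    have hle := (hsub.sublist.filter (fun c => decide (playerAt c.1 = playerAt I))).length_le
    rw [List.take_succ_eq_append_getElem hjlen, List.filter_append, List.length_append] at hle
    have hval : (choices h)[(j : ℕ)] = choiceAt h j := by simp [choices]
    rw [hval, List.filter_cons_of_pos (by simp [hI])] at hle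
    simp only [List.length_cons] at hle
    omega
  intro j k hjk
  rcases lt_trichotomy j k with h1 | h1 | h1
  · exact absurd hjk (key j k h1)
  · exact h1
  · exact absurd hjk.symm (key k j h1)

/-- The sum of the weights of the actions on the path of a history. -/
noncomputable def pathSum (x : G.Choice → ℝ) (h : G.Hist) : ℝ := ((choices h).map x).sum

theorem sysMatrix_mulVec_inl (hG : G.PerfectRecall) (σ : G.Assessment) (pairs : Finset G.HistPair)
    (x : G.Choice → ℝ)
    (q : {q : G.HistPair // q ∈ pairs ∧ ¬ (σ.belief q.1 q.2.1 = 0 ∧ σ.belief q.1 q.2.2 = 0)}) :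
    (sysMatrix σ pairs).mulVec x (Sum.inl q) =
      pathSum x q.1.2.1.toHist - pathSum x q.1.2.2.toHist := by
  classical
  have key : ∀ h : G.Hist, pathSum x h = ∑ c, (if c ∈ choices h then 1 else 0) * x c := by
    intro h
    rw [pathSum, ← List.sum_toFinset _ (hG.nodup_choices h)]
    simp only [ite_mul, one_mul, zero_mul, ← List.mem_toFinset, Finset.sum_ite_mem,
      Finset.univ_inter]
  rw [key, key, ← Finset.sum_sub_distrib]
  simp only [Matrix.mulVec, dotProduct]
  refine Finset.sum_congr rfl fun c _ => ?_
  rw [← sub_mul]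
  congr 1
  simp only [sysMatrix, Matrix.fromRows_apply_inl, Matrix.of_apply]
  by_cases h1 : c ∈ choices q.1.2.1.toHist <;> by_cases h2 : c ∈ choices q.1.2.2.toHist <;>
    simp [h1, h2]

theorem sysMatrix_mulVec_inr (σ : G.Assessment) (pairs : Finset G.HistPair)
    (x : G.Choice → ℝ) (c : G.Choice) :
    (sysMatrix σ pairs).mulVec x (Sum.inr c) = x c := by
  classical
  rw [sysMatrix, Matrix.fromRows_mulVec, Sum.elim_inr, Matrix.one_mulVec]

theorem exists_int_sysMatrix (σ : G.Assessment) (pairs : Finset G.HistPair) (i : Row σ pairs)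
    (c : G.Choice) : ∃ z : ℤ, sysMatrix σ pairs i c = z := by
  classical
  rcases i with q | d
  · simp only [sysMatrix, Matrix.fromRows_apply_inl, Matrix.of_apply]
    split_ifs
    · exact ⟨1, by simp⟩
    · exact ⟨-1, by simp⟩
    · exact ⟨0, by simp⟩
  · simp only [sysMatrix, Matrix.fromRows_apply_inr, Matrix.one_apply]
    split_ifs
    · exact ⟨1, by simp⟩
    · exact ⟨0, by simp⟩

namespace Assessment

theorem strat_pos_of_reach_pos {σ : G.Assessment} (hσ : ∀ h : G.Hist, 0 < σ.reach h)
    (c : G.Choice) : 0 < σ.strat c.1 c.2 := by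
  obtain ⟨h, hc⟩ := exists_mem_choices c
  refine lt_of_le_of_ne ((σ.strat_mem c.1).1 c.2) fun h0 => (hσ h).ne' ?_
  exact List.prod_eq_zero (List.mem_map.2 ⟨c, hc, h0.symm⟩)

theorem pathSum_log_strat {σ : G.Assessment} (hσ : ∀ h : G.Hist, 0 < σ.reach h) (h : G.Hist) :
    pathSum (fun c => Real.log (σ.strat c.1 c.2)) h = Real.log (σ.reach h) := by
  rw [← Real.exp_eq_exp, Real.exp_log (hσ h), reach, pathSum, Real.exp_list_sum, List.map_map]
  congr 1
  refine List.map_congr_left fun c _ => ?_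
  exact Real.exp_log (strat_pos_of_reach_pos hσ c)

theorem reachInfo_pos {σ : G.Assessment} (hσ : ∀ h : G.Hist, 0 < σ.reach h) (I : G.Info) :
    0 < σ.reachInfo I := by
  obtain ⟨h, hh⟩ := G.info_nonempty I.1 I.2
  exact Finset.sum_pos (fun h _ => hσ _) ⟨⟨h, hh⟩, Finset.mem_univ _⟩

theorem Consistent.limitSolvable (hG : G.PerfectRecall) {σ : G.Assessment} (hσ : σ.Consistent)
    (pairs : Finset G.HistPair) : LimitSolvable (sysMatrix σ pairs) (sysRhs σ pairs) := by
  obtain ⟨s, hstrat, hbelief, hs⟩ := hσ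
  refine ⟨fun n c => Real.log ((s n).strat c.1 c.2), ?_⟩
  have hs1 : ∀ n, ∀ h : G.Hist, 0 < (s n).reach h := fun n => (hs n).1
  have hbpos : ∀ n (I : G.Info) (h : HistIn I), 0 < (s n).belief I h := by
    intro n I h
    rw [(hs n).2]
    exact div_pos (hs1 n _) (reachInfo_pos (hs1 n) I)
  have hblim : ∀ (I : G.Info) (h : HistIn I),
      Tendsto (fun n => (s n).belief I h) atTop (𝓝 (σ.belief I h)) := fun I h =>
    tendsto_pi_nhds.1 (tendsto_pi_nhds.1 hbelief I) h
  have hslim : ∀ c : G.Choice,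
      Tendsto (fun n => (s n).strat c.1 c.2) atTop (𝓝 (σ.strat c.1 c.2)) := fun c =>
    tendsto_pi_nhds.1 (tendsto_pi_nhds.1 hstrat c.1) c.2
  rintro (⟨⟨I, h, h'⟩, hq, hne⟩ | c)
  · have hnonneg := (σ.belief_mem I).1
    have h1 := tendsto_coe_log_sub_log (fun n => hbpos n I h) (fun n => hbpos n I h')
      (hblim I h) (hblim I h') (by
        by_contra hcon
        rw [not_or, not_lt, not_lt] at hcon
        exact hne ⟨le_antisymm hcon.1 (hnonneg h), le_antisymm hcon.2 (hnonneg h')⟩)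
    refine h1.congr fun n => ?_
    rw [sysMatrix_mulVec_inl hG, pathSum_log_strat (hs1 n), pathSum_log_strat (hs1 n), (hs n).2,
      (hs n).2, Real.log_div (hs1 n _).ne' (reachInfo_pos (hs1 n) I).ne',
      Real.log_div (hs1 n _).ne' (reachInfo_pos (hs1 n) I).ne', sub_sub_sub_cancel_right]
  · have h1 := tendsto_coe_log_sub_log (fun n => strat_pos_of_reach_pos (hs1 n) c)
      (fun _ => one_pos) (hslim c) tendsto_const_nhds (Or.inr one_pos)
    refine h1.congr fun n => ?_
    rw [sysMatrix_mulVec_inr, Real.log_one, sub_zero]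

/-- The assessment induced by a completely mixed strategy profile through Bayes' rule. -/
noncomputable def ofStrat (β : ∀ I : G.Info, Action I → ℝ)
    (hβ : ∀ I, β I ∈ stdSimplex ℝ (Action I)) (hpos : ∀ I a, 0 < β I a) : G.Assessment where
  strat := β
  strat_mem := hβ
  belief I h := ((choices h.toHist).map fun c => β c.1 c.2).prod /
    ∑ h' : HistIn I, ((choices h'.toHist).map fun c => β c.1 c.2).prod
  belief_mem I := by
    have hp : ∀ h : G.Hist, 0 < ((choices h).map fun c => β c.1 c.2).prod := fun h =>
      List.prod_map_pos _ fun c => hpos c.1 c.2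
    obtain ⟨h, hh⟩ := G.info_nonempty I.1 I.2
    refine ⟨fun h => div_nonneg (hp _).le (Finset.sum_nonneg fun h _ => (hp _).le), ?_⟩
    rw [← Finset.sum_div, div_self]
    exact (Finset.sum_pos (fun h _ => hp h.toHist) ⟨⟨h, hh⟩, Finset.mem_univ _⟩).ne'

theorem ofStrat_reach_pos {β : ∀ I : G.Info, Action I → ℝ}
    (hβ : ∀ I, β I ∈ stdSimplex ℝ (Action I)) (hpos : ∀ I a, 0 < β I a) (h : G.Hist) :
    0 < (ofStrat β hβ hpos).reach h :=
  List.prod_map_pos _ fun c => hpos c.1 c.2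

/-- The normalizing factor of the weights `exp (x a)` at an information set. -/
noncomputable def partitionSum (x : G.Choice → ℝ) (I : G.Info) : ℝ :=
  ∑ a : Action I, Real.exp (x ⟨I, a⟩)

/-- The strategy profile with probabilities proportional to `exp (x a)`. -/
noncomputable def softmax (x : G.Choice → ℝ) (I : G.Info) (a : Action I) : ℝ :=
  Real.exp (x ⟨I, a⟩) / partitionSum x I

theorem nonempty_action (σ : G.Assessment) (I : G.Info) : Nonempty (Action I) := by
  by_contra h
  rw [not_nonempty_iff] at h
  simpa using (σ.strat_mem I).2

theorem partitionSum_pos (σ : G.Assessment) (x : G.Choice → ℝ) (I : G.Info) :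
    0 < partitionSum x I :=
  have := σ.nonempty_action I
  Finset.sum_pos (fun _ _ => Real.exp_pos _) Finset.univ_nonempty

theorem softmax_pos (σ : G.Assessment) (x : G.Choice → ℝ) (I : G.Info) (a : Action I) :
    0 < softmax x I a :=
  div_pos (Real.exp_pos _) (σ.partitionSum_pos x I)

theorem softmax_mem (σ : G.Assessment) (x : G.Choice → ℝ) (I : G.Info) :
    softmax x I ∈ stdSimplex ℝ (Action I) := by
  refine ⟨fun a => (σ.softmax_pos x I a).le, ?_⟩
  simp only [softmax]
  rw [← Finset.sum_div]
  exact div_self (σ.partitionSum_pos x I).ne'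

theorem prod_softmax (x : G.Choice → ℝ) (h : G.Hist) :
    ((choices h).map fun c => softmax x c.1 c.2).prod =
      Real.exp (pathSum x h) / ((choices h).map fun c => partitionSum x c.1).prod := by
  rw [pathSum, Real.exp_list_sum, List.map_map]
  induction choices h with
  | nil => simp
  | cons c l ih =>
    rw [List.map_cons, List.prod_cons, ih, List.map_cons, List.prod_cons, List.map_cons,
      List.prod_cons, softmax, div_mul_div_comm]
    rfl

theorem consistent_of_limitSolvable (hG : G.PerfectRecall) {σ : G.Assessment}
    {pairs : Finset G.HistPair}
    (hpairs : ∀ (I : G.Info) (h h' : HistIn I), h ≠ h' →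
      (⟨I, h, h'⟩ : G.HistPair) ∈ pairs ∨ (⟨I, h', h⟩ : G.HistPair) ∈ pairs)
    (hsol : LimitSolvable (sysMatrix σ pairs) (sysRhs σ pairs)) : σ.Consistent := by
  obtain ⟨x, hx⟩ := hsol
  have hexp : ∀ c : G.Choice, Tendsto (fun n => Real.exp (x n c)) atTop (𝓝 (σ.strat c.1 c.2)) := by
    intro c
    have h1 := hx (Sum.inr c)
    simp only [sysMatrix_mulVec_inr] at h1
    simpa using tendsto_exp_mul_of_tendsto_coe ((σ.strat_mem c.1).1 c.2) one_pos h1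
  have hZ : ∀ I, Tendsto (fun n => partitionSum (x n) I) atTop (𝓝 1) := by
    intro I
    rw [← (σ.strat_mem I).2]
    exact tendsto_finsetSum _ fun a _ => hexp ⟨I, a⟩
  have hD : ∀ h : G.Hist, Tendsto
      (fun n => ((choices h).map fun c => partitionSum (x n) c.1).prod) atTop (𝓝 1) := by
    intro h
    induction choices h with
    | nil => simp
    | cons c l ih =>
      simp only [List.map_cons, List.prod_cons]
      simpa only [mul_one] using (hZ c.1).mul ih
  have hratio : ∀ (I : G.Info) (h h₀ : HistIn I), 0 < σ.belief I h₀ → Tendsto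
      (fun n => Real.exp (pathSum (x n) h.toHist - pathSum (x n) h₀.toHist) * σ.belief I h₀) atTop
      (𝓝 (σ.belief I h)) := by
    intro I h h₀ h0
    have hnn := (σ.belief_mem I).1 h
    by_cases heq : h = h₀
    · subst heq
      simp
    refine tendsto_exp_mul_of_tendsto_coe hnn h0 ?_
    rcases hpairs I h h₀ heq with hq | hq
    · have h1 := hx (Sum.inl ⟨⟨I, h, h₀⟩, hq, fun h2 => h0.ne' h2.2⟩)
      simp only [sysMatrix_mulVec_inl hG] at h1
      exact h1
    · have h1 := hx (Sum.inl ⟨⟨I, h₀, h⟩, hq, fun h2 => h0.ne' h2.1⟩)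
      simp only [sysMatrix_mulVec_inl hG] at h1
      have h2 := (continuous_neg.tendsto _).comp h1
      have h3 : -sysRhs σ pairs (Sum.inl ⟨⟨I, h₀, h⟩, hq, fun h2 => h0.ne' h2.1⟩) =
          ENNReal.log (ENNReal.ofReal (σ.belief I h)) -
            ENNReal.log (ENNReal.ofReal (σ.belief I h₀)) := by
        change -(ENNReal.log (ENNReal.ofReal (σ.belief I h₀)) -
          ENNReal.log (ENNReal.ofReal (σ.belief I h))) = _
        rw [ENNReal.log_ofReal_of_pos h0, EReal.neg_sub (Or.inl (EReal.coe_ne_bot _))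
          (Or.inl (EReal.coe_ne_top _)), add_comm, sub_eq_add_neg]
      rw [h3] at h2
      refine h2.congr fun n => ?_
      simp only [Function.comp_apply]
      rw [← EReal.coe_neg, neg_sub]
  refine ⟨fun n => ofStrat (softmax (x n)) (σ.softmax_mem (x n)) (σ.softmax_pos (x n)),
    ?_, ?_, fun n => ⟨ofStrat_reach_pos _ _, fun I h => rfl⟩⟩
  · refine tendsto_pi_nhds.2 fun I => tendsto_pi_nhds.2 fun a => ?_
    have h1 := (hexp ⟨I, a⟩).div (hZ I) one_ne_zero
    rw [div_one] at h1
    exact h1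
  · refine tendsto_pi_nhds.2 fun I => tendsto_pi_nhds.2 fun h => ?_
    obtain ⟨h₀, h0⟩ : ∃ h₀, 0 < σ.belief I h₀ := by
      by_contra hno
      push Not at hno
      have h1 := (σ.belief_mem I).2
      rw [Finset.sum_eq_zero fun h _ => le_antisymm (hno h) ((σ.belief_mem I).1 h)] at h1
      exact zero_ne_one h1
    let P : ℕ → HistIn I → ℝ := fun n h =>
      ((choices h.toHist).map fun c => softmax (x n) c.1 c.2).prod
    have hPpos : ∀ n h, 0 < P n h := fun n h =>
      List.prod_map_pos _ fun c => σ.softmax_pos (x n) c.1 c.2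
    have hP : ∀ h, Tendsto (fun n => P n h * (σ.belief I h₀ / P n h₀)) atTop
        (𝓝 (σ.belief I h)) := by
      intro h
      have h1 := (hratio I h h₀ h0).mul ((hD h₀.toHist).div (hD h.toHist) one_ne_zero)
      rw [div_one, mul_one] at h1
      refine h1.congr fun n => ?_
      have e1 : ∀ h : G.Hist, ((choices h).map fun c => partitionSum (x n) c.1).prod ≠ 0 :=
        fun h => (List.prod_map_pos (choices h) (f := fun c => partitionSum (x n) c.1)
          fun c => σ.partitionSum_pos (x n) c.1).ne'
      have e2 : ∀ u v d d₀ m : ℝ, v ≠ 0 → d ≠ 0 → d₀ ≠ 0 →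
          u / v * m * (d₀ / d) = u / d * (m / (v / d₀)) := by
        intros
        field_simp
      have e3 : ∀ h : HistIn I, P n h = Real.exp (pathSum (x n) h.toHist) /
          ((choices h.toHist).map fun c => partitionSum (x n) c.1).prod := fun h =>
        prod_softmax (x n) h.toHist
      rw [e3, e3, Pi.div_apply, Real.exp_sub]
      exact e2 (Real.exp (pathSum (x n) h.toHist)) (Real.exp (pathSum (x n) h₀.toHist)) _ _ _ (Real.exp_pos _).ne' (e1 _) (e1 _)
    have h2 := (hP h).div (tendsto_finsetSum Finset.univ fun h' _ => hP h')
      (by rw [(σ.belief_mem I).2]; exact one_ne_zero)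
    rw [(σ.belief_mem I).2, div_one] at h2
    refine h2.congr fun n => ?_
    simp only [Pi.div_apply]
    rw [← Finset.sum_mul, mul_div_mul_right _ _ (div_pos h0 (hPpos n h₀)).ne']
    rfl

end Assessment

end ExtensiveGame

theorem mainTheorem5 {Player Act : Type*} (G : ExtensiveGame Player Act) (hG : G.PerfectRecall)
    (σ : G.Assessment) (pairs : Finset G.HistPair)
    (hpairs : ∀ (I : G.Info) (h h' : ExtensiveGame.HistIn I), h ≠ h' →
      (⟨I, h, h'⟩ : G.HistPair) ∈ pairs ∨ (⟨I, h', h⟩ : G.HistPair) ∈ pairs) :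
    -- the finite test, for every conical basis of the cone
    (∀ E : Finset (ExtensiveGame.Row σ pairs → ℝ),
      IsConicalBasis (systemCone (ExtensiveGame.sysMatrix σ pairs)
        (ExtensiveGame.sysRhs σ pairs)) E →
      (σ.Consistent ↔ ∀ p ∈ E, SumZeroOrIllDefined (ExtensiveGame.sysRhs σ pairs) p)) ∧
    -- the choice of the conical basis is irrelevant
    (∀ E E' : Finset (ExtensiveGame.Row σ pairs → ℝ),
      IsConicalBasis (systemCone (ExtensiveGame.sysMatrix σ pairs)
        (ExtensiveGame.sysRhs σ pairs)) E →
      IsConicalBasis (systemCone (ExtensiveGame.sysMatrix σ pairs)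
        (ExtensiveGame.sysRhs σ pairs)) E' →
      ((∀ p ∈ E, SumZeroOrIllDefined (ExtensiveGame.sysRhs σ pairs) p) ↔
        ∀ p ∈ E', SumZeroOrIllDefined (ExtensiveGame.sysRhs σ pairs) p)) ∧
    -- a (finite) conical basis with integer components exists
    (∃ E : Finset (ExtensiveGame.Row σ pairs → ℝ),
      IsConicalBasis (systemCone (ExtensiveGame.sysMatrix σ pairs)
        (ExtensiveGame.sysRhs σ pairs)) E ∧
      ∀ p ∈ E, ∀ i, ∃ z : ℤ, p i = (z : ℝ)) := by
  refine ⟨fun E hE => ?_, fun E E' hE hE' => ?_, ?_⟩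
  · rw [← hE.limitSolvable_iff]
    exact ⟨fun h => h.limitSolvable hG pairs,
      ExtensiveGame.Assessment.consistent_of_limitSolvable hG hpairs⟩
  · rw [hE.forall_sumZeroOrIllDefined_iff, hE'.forall_sumZeroOrIllDefined_iff]
  · exact exists_integral_conicalBasis _ _ (ExtensiveGame.exists_int_sysMatrix σ pairs)
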